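/- All games are short (finite) two-player normal-play combinatorial games $X=\{X^L\mid X^R\}$. Games $Y,Z$ are equal if for every game $X$ the disjunctive sums $X+Y$ and $X+Z$ have the same outcome (Left win, Right win, next player win, or previous player win); the value of a game is its equality class. The birthday of a game is the greatest length of a (not necessarily alternating) sequence of moves starting from it. A value is born by day $b$ if it is the value of a game with birthday at most $b$. Let $\mathbb{G}_b$ be the set of values born by day $b$ and $g(b)=|\mathbb{G}_b|$. Given a finite digraph whose vertices are each colored blue or red, the Digraph Placement game on it is played as follows: on her turn Left chooses a remaining blue vertex, on his turn Right chooses a remaining red vertex, and the chosen vertex is deleted together with all its out-neighbours; a player who cannot move on their turn loses. For a value $X$ let $f(X)$ be the least number of vertices of a Digraph Placement game with value $X$, and let $F(b)=\max_{X\in\mathbb{G}_b} f(X)$. Theorem. For every integer $b\ge 1$, the quantities $g(b+1)$ and $F(b)$ are well defined (that is, $\mathbb{G}_{b+1}$ is finite, every $X\in\mathbb{G}_b$ is the value of some Digraph Placement game, and the maximum defining $F(b)$ is attained), and $$F(b) < \tfrac12\, g(b+1) - b .$$ -/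

import Mathlib

noncomputable section

/-- The two players. -/
inductive Player : Type
  | left
  | right

/-- The two vertex colors: Left plays the blue vertices, Right plays the red ones. -/
inductive VertexColor : Type
  | blue
  | red

/-- The four possible outcomes of a game under normal play. -/
inductive Outcome : Type
  | leftWin
  | rightWin
  | nextWin
  | previousWin

/-- Short combinatorial games: `mk α β L R` is the game `{L i | R j}` whose Left options
are the `L i`, `i : α`, and whose Right options are the `R j`, `j : β`, with `α` and `β` finite. -/
inductive ShortGame : Type 1
  | mk (α β : Type) [Finite α] [Finite β] (L : α → ShortGame) (R : β → ShortGame) : ShortGame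

namespace ShortGame

/-- Auxiliary recursion for the sum `{L i | R j} + Y`: here `addL i` stands for the function
`L i + ·` and `addR j` for `R j + ·`. -/
def addAux (α β : Type) [Finite α] [Finite β] (addL : α → ShortGame → ShortGame)
    (addR : β → ShortGame → ShortGame) : ShortGame → ShortGame
  | mk γ δ L' R' =>
    mk (α ⊕ γ) (β ⊕ δ)
      (Sum.elim (fun i => addL i (mk γ δ L' R')) (fun i => addAux α β addL addR (L' i)))
      (Sum.elim (fun j => addR j (mk γ δ L' R')) (fun j => addAux α β addL addR (R' j)))

/-- The disjunctive sum `X + Y`; see `mk_add_mk` for its defining equation. -/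
def add : ShortGame → ShortGame → ShortGame
  | mk α β L R => addAux α β (fun i => add (L i)) (fun j => add (R j))

instance : Add ShortGame := ⟨add⟩

/-- `X + Y = {Xᴸ + Y, X + Yᴸ | Xᴿ + Y, X + Yᴿ}`. -/
theorem mk_add_mk (α β γ δ : Type) [Finite α] [Finite β] [Finite γ] [Finite δ]
    (L : α → ShortGame) (R : β → ShortGame) (L' : γ → ShortGame) (R' : δ → ShortGame) :
    mk α β L R + mk γ δ L' R' =
      mk (α ⊕ γ) (β ⊕ δ)
        (Sum.elim (fun i => L i + mk γ δ L' R') (fun i => mk α β L R + L' i))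
        (Sum.elim (fun j => R j + mk γ δ L' R') (fun j => mk α β L R + R' j)) :=
  rfl

/-- `WinsFirst X p`: under normal play (a player who cannot move on their turn loses), player `p`
wins the game `X` when `p` is the one to move. -/
def WinsFirst : ShortGame → Player → Prop
  | mk _ _ L _, Player.left => ∃ i, ¬ WinsFirst (L i) Player.right
  | mk _ _ _ R, Player.right => ∃ j, ¬ WinsFirst (R j) Player.left

open Classical in
/-- The outcome of a game. -/
def outcome (X : ShortGame) : Outcome :=
  if X.WinsFirst Player.left then
    if X.WinsFirst Player.right then Outcome.nextWin else Outcome.leftWin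
  else
    if X.WinsFirst Player.right then Outcome.rightWin else Outcome.previousWin

/-- Equality of games: `Y = Z` iff `X + Y` and `X + Z` have the same outcome for every game `X`. -/
instance valueSetoid : Setoid ShortGame where
  r Y Z := ∀ X : ShortGame, (X + Y).outcome = (X + Z).outcome
  iseqv := ⟨fun _ _ => rfl, fun h X => (h X).symm, fun h h' X => (h X).trans (h' X)⟩

/-- The birthday of a game: the greatest length of a sequence of (not necessarily alternating)
moves starting from it. The suprema are over finite families of natural numbers, and the
supremum of the empty family is `0`. -/
def birthday : ShortGame → ℕ
  | mk _ _ L R => max (⨆ i, (birthday (L i) + 1)) (⨆ j, (birthday (R j) + 1))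

end ShortGame

/-- Game values: short games modulo equality. -/
def GameValue : Type 1 := Quotient ShortGame.valueSetoid

/-- The value of a game. -/
def ShortGame.value (X : ShortGame) : GameValue := Quotient.mk ShortGame.valueSetoid X

/-- A digraph with a (not necessarily proper) 2-coloring of its vertices. -/
structure ColoredDigraph (V : Type) where
  graph : Digraph V
  color : V → VertexColor

namespace ColoredDigraph

open Classical in
/-- The vertices of `S` that survive the deletion of the closed out-neighborhood of `v`. -/
def delete {V : Type} (D : ColoredDigraph V) (S : Finset V) (v : V) : Finset V :=
  S.filter (fun u => u ≠ v ∧ ¬ D.graph.Adj v u)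

theorem card_delete_lt {V : Type} (D : ColoredDigraph V) (S : Finset V) (v : V) (hv : v ∈ S) :
    (D.delete S v).card < S.card := by
  classical
  unfold delete
  exact Finset.card_lt_card (Finset.filter_ssubset.2 ⟨v, hv, fun h => h.1 rfl⟩)

/-- The position of the digraph placement game in which `S` is the set of vertices that have not
been deleted: Left chooses a blue vertex and Right a red vertex of `S`, which is deleted together
with all of its out-neighbors. -/
def position {V : Type} [Finite V] (D : ColoredDigraph V) (S : Finset V) : ShortGame :=
  ShortGame.mk {v : V // v ∈ S ∧ D.color v = VertexColor.blue}
    {v : V // v ∈ S ∧ D.color v = VertexColor.red}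
    (fun v => D.position (D.delete S v.1))
    (fun v => D.position (D.delete S v.1))
termination_by S.card
decreasing_by
  · exact D.card_delete_lt S v.1 v.2.1
  · exact D.card_delete_lt S v.1 v.2.1

theorem position_eq {V : Type} [Finite V] (D : ColoredDigraph V) (S : Finset V) :
    D.position S =
      ShortGame.mk {v : V // v ∈ S ∧ D.color v = VertexColor.blue}
        {v : V // v ∈ S ∧ D.color v = VertexColor.red}
        (fun v => D.position (D.delete S v.1))
        (fun v => D.position (D.delete S v.1)) := by
  conv_lhs => unfold position

/-- The digraph placement game played on `D`. -/
def game {V : Type} [Fintype V] (D : ColoredDigraph V) : ShortGame := D.position Finset.univ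

end ColoredDigraph

namespace GameValue

/-- `IsPlacementOrder x n`: some digraph placement game on exactly `n` vertices has value `x`. -/
def IsPlacementOrder (x : GameValue) (n : ℕ) : Prop :=
  ∃ (V : Type) (_ : Fintype V) (D : ColoredDigraph V), Fintype.card V = n ∧ D.game.value = x

/-- `f(x)`: the least number of vertices of a digraph placement game of value `x`. -/
def f (x : GameValue) : ℕ := sInf {n | x.IsPlacementOrder n}

/-- The set of values born by day `b`, i.e. of values of games of birthday at most `b`. -/
def bornBy (b : ℕ) : Set GameValue := {x | ∃ X : ShortGame, X.birthday ≤ b ∧ X.value = x}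

/-- `g(b)`: the number of values born by day `b`. -/
def g (b : ℕ) : ℕ := (bornBy b).ncard

/-- `F(b)`: the maximum of `f` over the values born by day `b`. -/
def F (b : ℕ) : ℕ := sSup (f '' bornBy b)

end GameValue

end

/-! Write w_b for the width (largest antichain) of the order on values born by day b. Dominated
options can be removed, so a value born by day b + 1 needs at most w_b options for each player.
Given digraphs for these options, `assembly` builds a digraph for the value: each option gets a
selector, whose choice deletes everything but that option's digraph. Any other first move is
punished by a reply in one of four reserve groups, after which only N - 1 independent vertices of
the replying player's color remain. For a game X born by day N - 1 that player likes this at least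
as much as X, so such first moves do not affect the value (`assembly_game_value`). Hence a vertex
bound M_b for day b yields M_(b+1) = 2 w_b (M_b + 1) + 4 (b + 2) (`PlacementBound.succ`).

For lower bounds, let A and A' be subsets of a maximum antichain of day b. No Left option of {A |
-b} is reversible, so {A | -b} ≤ {A' | -b} forces A ⊆ A'. Taking all subsets gives g(b + 1) ≥
2^(w_b) (`two_pow_width_le_g`); taking those of size k gives w_(b+1) ≥ C(w_b, k)
(`choose_width_le`). With k = 2 the width at least doubles once w_b ≥ 5, which beats the recursion
for M_b: M_b + b + 1 ≤ 2^(w_b - 1) for b ≥ 3. The base of this induction and the days b = 1, 2 rest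
on the computed bounds w_3 ≥ 10, g(2) ≥ 8 and g(3) > 76. -/

noncomputable section

/-! ### The order on short games and its relation to outcomes -/

namespace ShortGame

/-- `o` is a Left option of the game. -/
def LeftOpt (o : ShortGame) : ShortGame → Prop
  | mk _ _ L _ => ∃ i, L i = o

/-- `o` is a Right option of the game. -/
def RightOpt (o : ShortGame) : ShortGame → Prop
  | mk _ _ _ R => ∃ j, R j = o

theorem leftOpt_mk {α β : Type} [Finite α] [Finite β] {L : α → ShortGame} {R : β → ShortGame}
    {o : ShortGame} : LeftOpt o (mk α β L R) ↔ ∃ i, L i = o := Iff.rfl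

theorem rightOpt_mk {α β : Type} [Finite α] [Finite β] {L : α → ShortGame} {R : β → ShortGame}
    {o : ShortGame} : RightOpt o (mk α β L R) ↔ ∃ j, R j = o := Iff.rfl

theorem birthday_le_iff {X : ShortGame} {n : ℕ} :
    X.birthday ≤ n ↔
      (∀ l, LeftOpt l X → l.birthday < n) ∧ ∀ r, RightOpt r X → r.birthday < n := by
  obtain ⟨α, β, L, R⟩ := X
  simp only [birthday, max_le_iff, leftOpt_mk, rightOpt_mk, forall_exists_index,
    forall_apply_eq_imp_iff]
  have key : ∀ (γ : Type) [Finite γ] (f : γ → ShortGame),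
      (⨆ i, ((f i).birthday + 1)) ≤ n ↔ ∀ i, (f i).birthday < n := by
    intro γ _ f
    rcases isEmpty_or_nonempty γ with h | h
    · simp
    · exact ciSup_le_iff (Set.finite_range _).bddAbove
  rw [key, key]

theorem LeftOpt.birthday_lt {X l : ShortGame} (h : LeftOpt l X) : l.birthday < X.birthday :=
  (birthday_le_iff.1 le_rfl).1 l h

theorem RightOpt.birthday_lt {X r : ShortGame} (h : RightOpt r X) : r.birthday < X.birthday :=
  (birthday_le_iff.1 le_rfl).2 r h

/-- The usual order of games: `X ≤ Y` if no Left option of `X` is `≥ Y` and no Right option of `Y`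
is `≤ X`. -/
def le (X Y : ShortGame) : Prop :=
  (∀ l, (h : LeftOpt l X) → ¬ le Y l) ∧ ∀ r, (h : RightOpt r Y) → ¬ le r X
termination_by X.birthday + Y.birthday
decreasing_by
  · have := h.birthday_lt; omega
  · have := h.birthday_lt; omega

instance : LE ShortGame := ⟨le⟩

theorem le_def {X Y : ShortGame} :
    X ≤ Y ↔ (∀ l, LeftOpt l X → ¬ Y ≤ l) ∧ ∀ r, RightOpt r Y → ¬ r ≤ X := by
  change le X Y ↔ _
  rw [le]
  rfl

theorem not_le_def {X Y : ShortGame} :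
    ¬ X ≤ Y ↔ (∃ l, LeftOpt l X ∧ Y ≤ l) ∨ ∃ r, RightOpt r Y ∧ r ≤ X := by
  rw [le_def, not_and_or]
  push Not
  rfl

theorem LeftOpt.not_le_of_le {X Y l : ShortGame} (h : LeftOpt l X) (hXY : X ≤ Y) : ¬ Y ≤ l :=
  (le_def.1 hXY).1 l h

theorem RightOpt.not_le_of_le {X Y r : ShortGame} (h : RightOpt r Y) (hXY : X ≤ Y) : ¬ r ≤ X :=
  (le_def.1 hXY).2 r h

/-- Induction over the options of a game. -/
theorem optInduction {P : ShortGame → Prop}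
    (h : ∀ X, (∀ l, LeftOpt l X → P l) → (∀ r, RightOpt r X → P r) → P X) (X : ShortGame) :
    P X := by
  induction X with
  | mk α β L R ihL ihR =>
    refine h _ ?_ ?_
    · rintro _ ⟨i, rfl⟩; exact ihL i
    · rintro _ ⟨i, rfl⟩; exact ihR i

protected theorem le_refl (X : ShortGame) : X ≤ X := by
  induction X using optInduction with
  | h X ihL ihR =>
    exact le_def.2 ⟨fun l hl h => hl.not_le_of_le h (ihL l hl),
      fun r hr h => hr.not_le_of_le h (ihR r hr)⟩

/-- The three games rotate: a Left option `l` of `X` with `Z ≤ l` leads to the instance `Y ≤ Z ≤ l`,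
of smaller total birthday; Right options are dual. -/
protected theorem le_trans_aux (n : ℕ) : ∀ X Y Z : ShortGame,
    X.birthday + Y.birthday + Z.birthday ≤ n → X ≤ Y → Y ≤ Z → X ≤ Z := by
  induction n with
  | zero =>
    intro X Y Z hn _ _
    refine le_def.2 ⟨fun l hl => ?_, fun r hr => ?_⟩
    · have := hl.birthday_lt; omega
    · have := hr.birthday_lt; omega
  | succ n ih =>
    intro X Y Z hn hXY hYZ
    refine le_def.2 ⟨fun l hl h => ?_, fun r hr h => ?_⟩
    · have := hl.birthday_lt
      exact hl.not_le_of_le hXY (ih Y Z l (by omega) hYZ h)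
    · have := hr.birthday_lt
      exact hr.not_le_of_le hYZ (ih r X Y (by omega) h hXY)

instance : Preorder ShortGame where
  le_refl := ShortGame.le_refl
  le_trans X Y Z := ShortGame.le_trans_aux _ X Y Z le_rfl

theorem LeftOpt.not_le {X l : ShortGame} (h : LeftOpt l X) : ¬ X ≤ l :=
  h.not_le_of_le le_rfl

theorem RightOpt.not_le {X r : ShortGame} (h : RightOpt r X) : ¬ r ≤ X :=
  h.not_le_of_le le_rfl

theorem leftOpt_add {X Y o : ShortGame} :
    LeftOpt o (X + Y) ↔ (∃ l, LeftOpt l X ∧ o = l + Y) ∨ ∃ l, LeftOpt l Y ∧ o = X + l := by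
  obtain ⟨α, β, L, R⟩ := X
  obtain ⟨γ, δ, L', R'⟩ := Y
  rw [mk_add_mk]
  simp [leftOpt_mk, eq_comm]

theorem rightOpt_add {X Y o : ShortGame} :
    RightOpt o (X + Y) ↔ (∃ r, RightOpt r X ∧ o = r + Y) ∨ ∃ r, RightOpt r Y ∧ o = X + r := by
  obtain ⟨α, β, L, R⟩ := X
  obtain ⟨γ, δ, L', R'⟩ := Y
  rw [mk_add_mk]
  simp [rightOpt_mk, eq_comm]

theorem winsFirst_left {X : ShortGame} :
    X.WinsFirst Player.left ↔ ∃ l, LeftOpt l X ∧ ¬ l.WinsFirst Player.right := by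
  obtain ⟨α, β, L, R⟩ := X
  simp [leftOpt_mk, WinsFirst]

theorem winsFirst_right {X : ShortGame} :
    X.WinsFirst Player.right ↔ ∃ r, RightOpt r X ∧ ¬ r.WinsFirst Player.left := by
  obtain ⟨α, β, L, R⟩ := X
  simp [rightOpt_mk, WinsFirst]

/-- Left's winning move on `Z + X` is carried over to `Z + Y`. If it goes to a Left option `l` of
`X`, then `¬ Y ≤ l` supplies either a Left option of `Y` that is at least `l`, or a Right option `r`
of `l` with `r ≤ Y`. In the latter case Left wins moving first on `Z + r`, hence on `Z + Y` by
induction. -/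
theorem winsFirst_add_mono (n : ℕ) : ∀ Z X Y : ShortGame,
    Z.birthday + X.birthday + Y.birthday ≤ n → X ≤ Y →
      ((Z + X).WinsFirst Player.left → (Z + Y).WinsFirst Player.left) ∧
      ((Z + Y).WinsFirst Player.right → (Z + X).WinsFirst Player.right) := by
  induction n using Nat.strong_induction_on with
  | _ n ih =>
    intro Z X Y hn hXY
    constructor
    · intro h
      obtain ⟨o, ho, hw⟩ := winsFirst_left.1 h
      rcases leftOpt_add.1 ho with ⟨l, hl, rfl⟩ | ⟨l, hl, rfl⟩
      · have := hl.birthday_lt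
        exact winsFirst_left.2 ⟨l + Y, leftOpt_add.2 (Or.inl ⟨l, hl, rfl⟩),
          fun h' => hw ((ih _ (by omega) l X Y le_rfl hXY).2 h')⟩
      · have := hl.birthday_lt
        rcases not_le_def.1 (hl.not_le_of_le hXY) with ⟨m, hm, hlm⟩ | ⟨r, hr, hrY⟩
        · have := hm.birthday_lt
          exact winsFirst_left.2 ⟨Z + m, leftOpt_add.2 (Or.inr ⟨m, hm, rfl⟩),
            fun h' => hw ((ih _ (by omega) Z l m le_rfl hlm).2 h')⟩
        · have := hr.birthday_lt
          refine (ih _ (by omega) Z r Y le_rfl hrY).1 ?_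
          by_contra h'
          exact hw (winsFirst_right.2 ⟨Z + r, rightOpt_add.2 (Or.inr ⟨r, hr, rfl⟩), h'⟩)
    · intro h
      obtain ⟨o, ho, hw⟩ := winsFirst_right.1 h
      rcases rightOpt_add.1 ho with ⟨r, hr, rfl⟩ | ⟨r, hr, rfl⟩
      · have := hr.birthday_lt
        exact winsFirst_right.2 ⟨r + X, rightOpt_add.2 (Or.inl ⟨r, hr, rfl⟩),
          fun h' => hw ((ih _ (by omega) r X Y le_rfl hXY).1 h')⟩
      · have := hr.birthday_lt
        rcases not_le_def.1 (hr.not_le_of_le hXY) with ⟨l, hl, hXl⟩ | ⟨m, hm, hmr⟩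
        · have := hl.birthday_lt
          refine (ih _ (by omega) Z X l le_rfl hXl).2 ?_
          by_contra h'
          exact hw (winsFirst_left.2 ⟨Z + l, leftOpt_add.2 (Or.inr ⟨l, hl, rfl⟩), h'⟩)
        · have := hm.birthday_lt
          exact winsFirst_right.2 ⟨Z + m, rightOpt_add.2 (Or.inr ⟨m, hm, rfl⟩),
            fun h' => hw ((ih _ (by omega) Z m r le_rfl hmr).1 h')⟩

/-- The game with the roles of the players exchanged. -/
def neg : ShortGame → ShortGame
  | mk α β L R => mk β α (fun j => neg (R j)) (fun i => neg (L i))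

theorem leftOpt_neg {X o : ShortGame} : LeftOpt o X.neg ↔ ∃ r, RightOpt r X ∧ o = r.neg := by
  obtain ⟨α, β, L, R⟩ := X
  simp [neg, leftOpt_mk, rightOpt_mk, eq_comm]

theorem rightOpt_neg {X o : ShortGame} : RightOpt o X.neg ↔ ∃ l, LeftOpt l X ∧ o = l.neg := by
  obtain ⟨α, β, L, R⟩ := X
  simp [neg, leftOpt_mk, rightOpt_mk, eq_comm]

/-- The recursion for winning `-X + Y` matches that for `¬ X ≤ Y` option by option, so outcomes of
sums detect the order. -/
theorem winsFirst_neg_add (n : ℕ) : ∀ X Y : ShortGame, X.birthday + Y.birthday ≤ n →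
    ((X.neg + Y).WinsFirst Player.right ↔ ¬ X ≤ Y) ∧
    ((X.neg + Y).WinsFirst Player.left ↔ ¬ Y ≤ X) := by
  induction n using Nat.strong_induction_on with
  | _ n ih =>
    intro X Y hn
    constructor
    · rw [winsFirst_right, not_le_def]
      constructor
      · rintro ⟨o, ho, hw⟩
        rcases rightOpt_add.1 ho with ⟨r, hr, rfl⟩ | ⟨r, hr, rfl⟩
        · obtain ⟨l, hl, rfl⟩ := rightOpt_neg.1 hr
          have := hl.birthday_lt
          rw [(ih _ (by omega) l Y le_rfl).2, not_not] at hw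
          exact Or.inl ⟨l, hl, hw⟩
        · have := hr.birthday_lt
          rw [(ih _ (by omega) X r le_rfl).2, not_not] at hw
          exact Or.inr ⟨r, hr, hw⟩
      · rintro (⟨l, hl, h⟩ | ⟨r, hr, h⟩)
        · have := hl.birthday_lt
          refine ⟨l.neg + Y, rightOpt_add.2 (Or.inl ⟨_, rightOpt_neg.2 ⟨l, hl, rfl⟩, rfl⟩), ?_⟩
          rwa [(ih _ (by omega) l Y le_rfl).2, not_not]
        · have := hr.birthday_lt
          refine ⟨X.neg + r, rightOpt_add.2 (Or.inr ⟨r, hr, rfl⟩), ?_⟩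
          rwa [(ih _ (by omega) X r le_rfl).2, not_not]
    · rw [winsFirst_left, not_le_def]
      constructor
      · rintro ⟨o, ho, hw⟩
        rcases leftOpt_add.1 ho with ⟨l, hl, rfl⟩ | ⟨l, hl, rfl⟩
        · obtain ⟨r, hr, rfl⟩ := leftOpt_neg.1 hl
          have := hr.birthday_lt
          rw [(ih _ (by omega) r Y le_rfl).1, not_not] at hw
          exact Or.inr ⟨r, hr, hw⟩
        · have := hl.birthday_lt
          rw [(ih _ (by omega) X l le_rfl).1, not_not] at hw
          exact Or.inl ⟨l, hl, hw⟩
      · rintro (⟨l, hl, h⟩ | ⟨r, hr, h⟩)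
        · have := hl.birthday_lt
          refine ⟨X.neg + l, leftOpt_add.2 (Or.inr ⟨l, hl, rfl⟩), ?_⟩
          rwa [(ih _ (by omega) X l le_rfl).1, not_not]
        · have := hr.birthday_lt
          refine ⟨r.neg + Y, leftOpt_add.2 (Or.inl ⟨_, leftOpt_neg.2 ⟨r, hr, rfl⟩, rfl⟩), ?_⟩
          rwa [(ih _ (by omega) r Y le_rfl).1, not_not]

theorem winsFirst_iff_of_outcome_eq {X Y : ShortGame} (h : X.outcome = Y.outcome) :
    (X.WinsFirst Player.left ↔ Y.WinsFirst Player.left) ∧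
    (X.WinsFirst Player.right ↔ Y.WinsFirst Player.right) := by
  unfold outcome at h
  split_ifs at h <;> simp_all

/-- Two games have the same value if and only if each is `≤` the other. -/
theorem value_eq_iff {X Y : ShortGame} : X.value = Y.value ↔ X ≤ Y ∧ Y ≤ X := by
  refine (Quotient.eq (r := valueSetoid)).trans ⟨fun h => ?_, fun ⟨h, h'⟩ Z => ?_⟩
  -- The test game is `-X`: nobody wins `-X + X` moving first, because `X ≤ X`.
  · have hX := winsFirst_iff_of_outcome_eq (h X.neg)
    have e := winsFirst_neg_add _ X X le_rfl
    have e' := winsFirst_neg_add _ X Y le_rfl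
    rw [e.1, e.2, e'.1, e'.2] at hX
    exact ⟨(not_iff_not.1 hX.2).1 le_rfl, (not_iff_not.1 hX.1).1 le_rfl⟩
  · have e := winsFirst_add_mono _ Z X Y le_rfl h
    have e' := winsFirst_add_mono _ Z Y X le_rfl h'
    unfold outcome
    rw [propext (⟨e.1, e'.1⟩ : (Z + X).WinsFirst Player.left ↔ (Z + Y).WinsFirst Player.left),
      propext (⟨e'.2, e.2⟩ : (Z + X).WinsFirst Player.right ↔ (Z + Y).WinsFirst Player.right)]

/-- Options that match up to `≤` give comparable games. -/
theorem le_of_options {X Y : ShortGame}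
    (hl : ∀ l, LeftOpt l X → (∃ m, LeftOpt m Y ∧ l ≤ m) ∨ ∃ r, RightOpt r l ∧ r ≤ Y)
    (hr : ∀ r, RightOpt r Y → (∃ m, RightOpt m X ∧ m ≤ r) ∨ ∃ l, LeftOpt l r ∧ X ≤ l) :
    X ≤ Y :=
  le_def.2 ⟨fun l h => not_le_def.2 (hl l h), fun r h => not_le_def.2 (hr r h).symm⟩

/-- The negative integer `-n`. -/
def negNat : ℕ → ShortGame
  | 0 => mk Empty Empty Empty.elim Empty.elim
  | n + 1 => mk Empty Unit Empty.elim (fun _ => negNat n)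

theorem not_leftOpt_negNat {n : ℕ} {o : ShortGame} : ¬ LeftOpt o (negNat n) := by
  cases n <;> rintro ⟨⟨⟩, _⟩

theorem birthday_negNat_le (n : ℕ) : (negNat n).birthday ≤ n := by
  induction n with
  | zero => exact birthday_le_iff.2 ⟨fun l h => (not_leftOpt_negNat h).elim, by rintro _ ⟨⟨⟩, _⟩⟩
  | succ n ih =>
    refine birthday_le_iff.2 ⟨fun l h => (not_leftOpt_negNat h).elim, ?_⟩
    rintro _ ⟨_, rfl⟩
    exact Nat.lt_succ_of_le ih

/-- A failure means a Right option `r` of `X` with `r ≤ -n`. By induction `-(n-1) ≤ r`, so `-(n-1) ≤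
-n`, although `-(n-1)` is a Right option of `-n`. -/
theorem negNat_le {X : ShortGame} {n : ℕ} (h : X.birthday ≤ n) : negNat n ≤ X := by
  induction n generalizing X with
  | zero =>
    refine le_def.2 ⟨fun l hl => (not_leftOpt_negNat hl).elim, fun r hr => ?_⟩
    exact absurd hr.birthday_lt (by omega)
  | succ n ih =>
    refine le_def.2 ⟨fun l hl => (not_leftOpt_negNat hl).elim, fun r hr hle => ?_⟩
    have := hr.birthday_lt
    have h1 : RightOpt (negNat n) (negNat (n + 1)) := ⟨(), rfl⟩
    exact h1.not_le ((ih (by omega)).trans hle)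

end ShortGame

end

/-! ### Positions of digraph placement games -/

noncomputable section

namespace ColoredDigraph

open ShortGame

variable {V W : Type}

theorem mem_delete {D : ColoredDigraph V} {S : Finset V} {u v : V} :
    u ∈ D.delete S v ↔ u ∈ S ∧ u ≠ v ∧ ¬ D.graph.Adj v u := by
  simp [delete]

theorem leftOpt_position [Finite V] {D : ColoredDigraph V} {S : Finset V} {o : ShortGame} :
    LeftOpt o (D.position S) ↔
      ∃ v ∈ S, D.color v = VertexColor.blue ∧ o = D.position (D.delete S v) := by
  rw [position_eq, leftOpt_mk]
  constructor
  · rintro ⟨⟨v, hv, hc⟩, rfl⟩; exact ⟨v, hv, hc, rfl⟩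
  · rintro ⟨v, hv, hc, rfl⟩; exact ⟨⟨v, hv, hc⟩, rfl⟩

theorem rightOpt_position [Finite V] {D : ColoredDigraph V} {S : Finset V} {o : ShortGame} :
    RightOpt o (D.position S) ↔
      ∃ v ∈ S, D.color v = VertexColor.red ∧ o = D.position (D.delete S v) := by
  rw [position_eq, rightOpt_mk]
  constructor
  · rintro ⟨⟨v, hv, hc⟩, rfl⟩; exact ⟨v, hv, hc, rfl⟩
  · rintro ⟨v, hv, hc, rfl⟩; exact ⟨⟨v, hv, hc⟩, rfl⟩

theorem delete_eq_erase [DecidableEq V] {D : ColoredDigraph V} {S : Finset V}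
    (h : ∀ u ∈ S, ∀ v ∈ S, ¬ D.graph.Adj u v) {v : V} (hv : v ∈ S) : D.delete S v = S.erase v := by
  ext u
  rw [mem_delete, Finset.mem_erase]
  exact ⟨fun hu => ⟨hu.2.1, hu.1⟩, fun hu => ⟨hu.2, hu.1, h v hv u hu.2⟩⟩

/-- An independent set of `n` red vertices is at most every game born by day `n`. -/
theorem position_le_of_red [Finite V] {D : ColoredDigraph V} {S : Finset V}
    (hc : ∀ v ∈ S, D.color v = VertexColor.red) (hS : ∀ u ∈ S, ∀ v ∈ S, ¬ D.graph.Adj u v)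
    {X : ShortGame} (hX : X.birthday ≤ S.card) : D.position S ≤ X := by
  classical
  induction S using Finset.strongInduction generalizing X with
  | H S ih =>
    refine le_def.2 ⟨fun l hl => ?_, fun r hr hle => ?_⟩
    · obtain ⟨v, hv, hb, -⟩ := leftOpt_position.1 hl
      simp [hc v hv] at hb
    · have hlt := hr.birthday_lt
      obtain ⟨v, hv⟩ : S.Nonempty := Finset.card_pos.1 (by omega)
      have ho : RightOpt (D.position (S.erase v)) (D.position S) :=
        rightOpt_position.2 ⟨v, hv, hc v hv, by rw [delete_eq_erase hS hv]⟩
      refine ho.not_le (le_trans (ih _ (Finset.erase_ssubset hv) ?_ ?_ ?_) hle)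
      · exact fun u hu => hc u (Finset.mem_of_mem_erase hu)
      · exact fun u hu w hw => hS u (Finset.mem_of_mem_erase hu) w (Finset.mem_of_mem_erase hw)
      · rw [Finset.card_erase_of_mem hv]; omega

/-- An independent set of `n` blue vertices is at least every game born by day `n`. -/
theorem le_position_of_blue [Finite V] {D : ColoredDigraph V} {S : Finset V}
    (hc : ∀ v ∈ S, D.color v = VertexColor.blue) (hS : ∀ u ∈ S, ∀ v ∈ S, ¬ D.graph.Adj u v)
    {X : ShortGame} (hX : X.birthday ≤ S.card) : X ≤ D.position S := by
  classical
  induction S using Finset.strongInduction generalizing X with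
  | H S ih =>
    refine le_def.2 ⟨fun l hl hle => ?_, fun r hr => ?_⟩
    · have hlt := hl.birthday_lt
      obtain ⟨v, hv⟩ : S.Nonempty := Finset.card_pos.1 (by omega)
      have ho : LeftOpt (D.position (S.erase v)) (D.position S) :=
        leftOpt_position.2 ⟨v, hv, hc v hv, by rw [delete_eq_erase hS hv]⟩
      refine ho.not_le (le_trans hle (ih _ (Finset.erase_ssubset hv) ?_ ?_ ?_))
      · exact fun u hu => hc u (Finset.mem_of_mem_erase hu)
      · exact fun u hu w hw => hS u (Finset.mem_of_mem_erase hu) w (Finset.mem_of_mem_erase hw)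
      · rw [Finset.card_erase_of_mem hv]; omega
    · obtain ⟨v, hv, hb, -⟩ := rightOpt_position.1 hr
      simp [hc v hv] at hb

theorem delete_map {D : ColoredDigraph V} {D' : ColoredDigraph W} {e : V ↪ W}
    (ha : ∀ u v, D'.graph.Adj (e u) (e v) ↔ D.graph.Adj u v) (S : Finset V) (v : V) :
    D'.delete (S.map e) (e v) = (D.delete S v).map e := by
  ext w
  simp only [mem_delete, Finset.mem_map]
  constructor
  · rintro ⟨⟨u, hu, rfl⟩, hne, hadj⟩
    exact ⟨u, ⟨hu, fun h => hne (h ▸ rfl), fun h => hadj ((ha v u).2 h)⟩, rfl⟩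
  · rintro ⟨u, ⟨hu, hne, hadj⟩, rfl⟩
    exact ⟨⟨u, hu, rfl⟩, fun h => hne (e.injective h), fun h => hadj ((ha v u).1 h)⟩

/-- Positions that correspond under an embedding of colored digraphs have the same value. -/
theorem position_map [Finite V] [Finite W] {D : ColoredDigraph V} {D' : ColoredDigraph W}
    {e : V ↪ W} (hc : ∀ v, D'.color (e v) = D.color v)
    (ha : ∀ u v, D'.graph.Adj (e u) (e v) ↔ D.graph.Adj u v) (S : Finset V) :
    D'.position (S.map e) ≤ D.position S ∧ D.position S ≤ D'.position (S.map e) := by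
  induction h : S.card using Nat.strong_induction_on generalizing S with
  | _ n ih =>
    have key : ∀ v ∈ S, D'.position (D'.delete (S.map e) (e v)) ≤ D.position (D.delete S v) ∧
        D.position (D.delete S v) ≤ D'.position (D'.delete (S.map e) (e v)) := by
      intro v hv
      rw [delete_map ha]
      exact ih _ (h ▸ D.card_delete_lt S v hv) _ rfl
    constructor
    · refine le_of_options (fun l hl => ?_) fun r hr => ?_
      · obtain ⟨w, hw, hb, rfl⟩ := leftOpt_position.1 hl
        obtain ⟨v, hv, rfl⟩ := Finset.mem_map.1 hw
        exact Or.inl ⟨_, leftOpt_position.2 ⟨v, hv, (hc v).symm.trans hb, rfl⟩, (key v hv).1⟩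
      · obtain ⟨v, hv, hb, rfl⟩ := rightOpt_position.1 hr
        exact Or.inl ⟨_, rightOpt_position.2
          ⟨e v, Finset.mem_map_of_mem e hv, (hc v).trans hb, rfl⟩, (key v hv).1⟩
    · refine le_of_options (fun l hl => ?_) fun r hr => ?_
      · obtain ⟨v, hv, hb, rfl⟩ := leftOpt_position.1 hl
        exact Or.inl ⟨_, leftOpt_position.2
          ⟨e v, Finset.mem_map_of_mem e hv, (hc v).trans hb, rfl⟩, (key v hv).2⟩
      · obtain ⟨w, hw, hb, rfl⟩ := rightOpt_position.1 hr
        obtain ⟨v, hv, rfl⟩ := Finset.mem_map.1 hw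
        exact Or.inl ⟨_, rightOpt_position.2 ⟨v, hv, (hc v).symm.trans hb, rfl⟩, (key v hv).2⟩

end ColoredDigraph

/-! ### The assembly of digraphs for the options of a game -/

/-- The vertices of the assembly of a family of digraphs with vertex types `V i`: one selector for
each index, the vertices of the digraphs themselves, and four reserve groups of `N` vertices. -/
inductive AssemblyVertex {ι : Type} (V : ι → Type) (N : ℕ) : Type
  | selector (i : ι) : AssemblyVertex V N
  | core (i : ι) (v : V i) : AssemblyVertex V N
  | reserve (t : Fin 4) (k : Fin N) : AssemblyVertex V N

namespace AssemblyVertex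

variable {ι : Type} {V : ι → Type} {N : ℕ}

/-- The vertices of an assembly as a sum type. -/
def equivSum : AssemblyVertex V N ≃ ι ⊕ (Σ i, V i) ⊕ (Fin 4 × Fin N) where
  toFun
    | selector i => Sum.inl i
    | core i v => Sum.inr (Sum.inl ⟨i, v⟩)
    | reserve t k => Sum.inr (Sum.inr (t, k))
  invFun := Sum.elim selector (Sum.elim (fun p => core p.1 p.2) (fun p => reserve p.1 p.2))
  left_inv x := by cases x <;> rfl
  right_inv x := by rcases x with i | p | p <;> rfl

instance [Fintype ι] [∀ i, Fintype (V i)] : Fintype (AssemblyVertex V N) :=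
  Fintype.ofEquiv _ equivSum.symm

theorem card_eq [Fintype ι] [∀ i, Fintype (V i)] :
    Fintype.card (AssemblyVertex V N) = Fintype.card ι + ∑ i, Fintype.card (V i) + 4 * N := by
  rw [Fintype.card_congr equivSum]
  simp [add_assoc]

/-- The inclusion of the `i`-th digraph. -/
def coreEmb (i : ι) : V i ↪ AssemblyVertex V N := ⟨core i, fun u v h => by simpa using h⟩

/-- The inclusion of the reserve group `t`. -/
def reserveEmb (t : Fin 4) : Fin N ↪ AssemblyVertex V N :=
  ⟨reserve t, fun u v h => by simpa using h⟩

/-- `Survives D x y`: the vertex `y` of the assembly is not an out-neighbor of `x`. -/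
def Survives (D : ∀ i, ColoredDigraph (V i)) : AssemblyVertex V N → AssemblyVertex V N → Prop
  | selector i, core j _ => i = j
  | core i v, core j w => ∃ h : i = j, ¬ (D j).graph.Adj (h ▸ v) w
  | core i v, reserve t _ => (D i).color v = VertexColor.blue ∧ t = 0 ∨
      (D i).color v = VertexColor.red ∧ t = 1
  | reserve s _, reserve t _ => t = s ∨ t = s + 1
  | _, _ => False

/-- The color of the reserve group `t`. -/
def reserveColor (t : Fin 4) : VertexColor :=
  if t = 0 ∨ t = 2 then VertexColor.red else VertexColor.blue

end AssemblyVertex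

open AssemblyVertex ShortGame

/-- The assembly of the digraphs `D i`, with selectors colored by `c`. A selector leaves only its
digraph; any other vertex leaves a reserve group of the opponent that punishes the move. -/
def assembly {ι : Type} {V : ι → Type} (c : ι → VertexColor) (D : ∀ i, ColoredDigraph (V i))
    (N : ℕ) : ColoredDigraph (AssemblyVertex V N) where
  graph := ⟨fun x y => ¬ Survives D x y⟩
  color
    | selector i => c i
    | core i v => (D i).color v
    | reserve t _ => reserveColor t

section

variable {ι : Type} {V : ι → Type} {c : ι → VertexColor} {D : ∀ i, ColoredDigraph (V i)} {N : ℕ}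

theorem mem_assembly_delete {S : Finset (AssemblyVertex V N)} {x y : AssemblyVertex V N} :
    y ∈ (assembly c D N).delete S x ↔ y ∈ S ∧ y ≠ x ∧ Survives D x y := by
  rw [ColoredDigraph.mem_delete]
  exact and_congr_right fun _ => and_congr_right fun _ => not_not

theorem reserve_not_adj (s : Fin 4) (T : Finset (Fin N)) :
    ∀ u ∈ T.map (reserveEmb s), ∀ v ∈ T.map (reserveEmb s),
      ¬ (assembly c D N).graph.Adj u v := by
  intro u hu v hv
  obtain ⟨k, -, rfl⟩ := Finset.mem_map.1 hu
  obtain ⟨k', -, rfl⟩ := Finset.mem_map.1 hv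
  exact not_not.2 (Or.inl rfl)

/-- The reserve group that punishes a move outside the selectors. -/
theorem exists_punisher {x : AssemblyVertex V N} (hx : ∀ i, x ≠ selector i) :
    ∃ s : Fin 4, reserveColor s ≠ (assembly c D N).color x ∧ ∀ k : Fin N,
      (∀ k, x ≠ reserve s k ∧ Survives D x (reserve s k)) ∧
      ∀ y, Survives D x y → Survives D (reserve s k) y → ∃ k', reserve s k' = y := by
  cases x with
  | selector i => exact (hx i rfl).elim
  | core i v =>
    cases hv : (D i).color v with
    | blue =>
      refine ⟨0, by simp [assembly, hv, reserveColor], fun k => ⟨by simp [Survives, hv], ?_⟩⟩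
      rintro (_ | _ | ⟨t, k'⟩) h h'
      · exact h'.elim
      · exact h'.elim
      · simp only [Survives, hv] at h
        exact ⟨k', by simp_all⟩
    | red =>
      refine ⟨1, by simp [assembly, hv, reserveColor], fun k => ⟨by simp [Survives, hv], ?_⟩⟩
      rintro (_ | _ | ⟨t, k'⟩) h h'
      · exact h'.elim
      · exact h'.elim
      · simp only [Survives, hv] at h
        exact ⟨k', by simp_all⟩
  | reserve t k =>
    -- The move leaves groups t and t + 1, the reply leaves t + 1 and t + 2. Four groups in a cycle
    -- keep t + 2 apart from t and still let the colors alternate.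
    refine ⟨t + 1, ?_, fun k => ⟨fun k' => ⟨?_, Or.inr rfl⟩, ?_⟩⟩
    · simp only [assembly, reserveColor]
      fin_cases t <;> simp
    · simp
    · rintro (_ | _ | ⟨u, k'⟩) h h'
      · exact h.elim
      · exact h.elim
      · refine ⟨k', ?_⟩
        simp only [Survives] at h h'
        congr 1
        clear hx
        revert t u
        decide

variable [Fintype ι] [∀ i, Fintype (V i)]

theorem assembly_position_selector (i : ι) :
    (assembly c D N).position ((assembly c D N).delete Finset.univ (selector i)) ≤ (D i).game ∧
    (D i).game ≤
      (assembly c D N).position ((assembly c D N).delete Finset.univ (selector i)) := by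
  have h : (assembly c D N).delete Finset.univ (selector i) = Finset.univ.map (coreEmb i) := by
    ext y
    rw [mem_assembly_delete]
    constructor
    · rintro ⟨-, -, h⟩
      obtain _ | ⟨j, v⟩ | _ := y
      · exact h.elim
      · obtain rfl : i = j := h
        exact Finset.mem_map_of_mem (coreEmb i) (Finset.mem_univ v)
      · exact h.elim
    · intro h
      obtain ⟨v, -, rfl⟩ := Finset.mem_map.1 h
      exact ⟨Finset.mem_univ _, by simp [coreEmb], rfl⟩
  rw [h]
  refine ColoredDigraph.position_map (fun v => rfl) (fun u v => ?_) Finset.univ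
  change ¬ (∃ h : i = i, ¬ (D i).graph.Adj (h ▸ u) v) ↔ _
  simp

/-- After a move `x` that leaves a reserve group `s`, and a reply in that group, only the rest of
that group is left. -/
theorem assembly_delete_delete {x : AssemblyVertex V N} {s : Fin 4} (k : Fin N)
    (hx : ∀ k, x ≠ reserve s k ∧ Survives D x (reserve s k))
    (hxs : ∀ y, Survives D x y → Survives D (reserve s k) y → ∃ k', reserve s k' = y) :
    (assembly c D N).delete ((assembly c D N).delete Finset.univ x) (reserve s k) =
      (Finset.univ.erase k).map (reserveEmb s) := by
  ext y
  simp only [mem_assembly_delete, Finset.mem_map, Finset.mem_erase, Finset.mem_univ, and_true,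
    true_and]
  constructor
  · rintro ⟨⟨-, h1⟩, h2, h3⟩
    obtain ⟨k', rfl⟩ := hxs y h1 h3
    exact ⟨k', fun h => h2 (h ▸ rfl), rfl⟩
  · rintro ⟨k', hk, rfl⟩
    exact ⟨⟨(hx k').1.symm, (hx k').2⟩, fun h => hk ((reserveEmb s).injective h), Or.inl rfl⟩

theorem reserve_mem_of_survives {x : AssemblyVertex V N} {s : Fin 4} (k : Fin N)
    (hx : ∀ k, x ≠ reserve s k ∧ Survives D x (reserve s k)) :
    reserve s k ∈ (assembly c D N).delete Finset.univ x :=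
  mem_assembly_delete.2 ⟨Finset.mem_univ _, (hx k).1.symm, (hx k).2⟩

/-- If the digraphs of an assembly have the values of the options of `X`, and the reserve groups
have more vertices than the birthday of `X`, then the assembly has the value of `X`. The reserve
groups are not needed if all these digraphs are empty. -/
theorem assembly_game_value {X : ShortGame}
    (hl : ∀ i, c i = VertexColor.blue → ∃ l, LeftOpt l X ∧ (D i).game.value = l.value)
    (hl' : ∀ l, LeftOpt l X → ∃ i, c i = VertexColor.blue ∧ (D i).game.value = l.value)
    (hr : ∀ i, c i = VertexColor.red → ∃ r, RightOpt r X ∧ (D i).game.value = r.value)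
    (hr' : ∀ r, RightOpt r X → ∃ i, c i = VertexColor.red ∧ (D i).game.value = r.value)
    (hN : (N = 0 ∧ ∀ i, IsEmpty (V i)) ∨ X.birthday < N) :
    (assembly c D N).game.value = X.value := by
  -- Without reserves and with empty digraphs every vertex is a selector, so any other vertex forces
  -- the second case of `hN`.
  have hpos : ∀ x : AssemblyVertex V N, (∀ i, x ≠ selector i) → X.birthday < N := by
    intro x hx
    rcases hN with ⟨rfl, h⟩ | h
    · cases x with
      | selector i => exact (hx i rfl).elim
      | core i v => exact (h i).elim v
      | reserve t k => exact k.elim0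
    · exact h
  have hcard : ∀ (s : Fin 4) (k : Fin N), X.birthday < N →
      X.birthday ≤ ((Finset.univ.erase k).map (reserveEmb (V := V) s)).card := by
    intro s k h
    rw [Finset.card_map, Finset.card_erase_of_mem (Finset.mem_univ _), Finset.card_fin]
    omega
  have hcol : ∀ (s : Fin 4) (k : Fin N), ∀ v ∈ (Finset.univ.erase k).map (reserveEmb (V := V) s),
      (assembly c D N).color v = reserveColor s := by
    intro s k v hv
    obtain ⟨k', -, rfl⟩ := Finset.mem_map.1 hv
    rfl
  refine value_eq_iff.2 ⟨le_of_options (fun o ho => ?_) fun o ho => ?_,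
    le_of_options (fun o ho => ?_) fun o ho => ?_⟩
  · obtain ⟨x, -, hb, rfl⟩ := ColoredDigraph.leftOpt_position.1 ho
    by_cases hx : ∃ i, x = selector i
    · obtain ⟨i, rfl⟩ := hx
      obtain ⟨l, hlX, hv⟩ := hl i hb
      exact Or.inl ⟨l, hlX, (assembly_position_selector i).1.trans (value_eq_iff.1 hv).1⟩
    · push Not at hx
      obtain ⟨s, hs, h⟩ := exists_punisher (c := c) (D := D) hx
      have hs' : reserveColor s = VertexColor.red := by
        rw [hb] at hs; cases hc : reserveColor s <;> simp_all
      have hlt := hpos x hx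
      have k : Fin N := ⟨0, by omega⟩
      -- Right's reply leaves N - 1 independent red vertices, a position at most `X`; Left's move
      -- `x` is thus no obstacle to `≤ X`.
      refine Or.inr ⟨_, ColoredDigraph.rightOpt_position.2
        ⟨reserve s k, reserve_mem_of_survives k (h k).1, hs', rfl⟩, ?_⟩
      rw [assembly_delete_delete k (h k).1 (h k).2]
      exact ColoredDigraph.position_le_of_red (fun v hv => (hcol s k v hv).trans hs')
        (reserve_not_adj s _) (hcard s k hlt)
  · obtain ⟨i, hc, hv⟩ := hr' o ho
    exact Or.inl ⟨_, ColoredDigraph.rightOpt_position.2 ⟨selector i, Finset.mem_univ _, hc, rfl⟩,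
      (assembly_position_selector i).1.trans (value_eq_iff.1 hv).1⟩
  · obtain ⟨i, hc, hv⟩ := hl' o ho
    exact Or.inl ⟨_, ColoredDigraph.leftOpt_position.2 ⟨selector i, Finset.mem_univ _, hc, rfl⟩,
      (value_eq_iff.1 hv).2.trans (assembly_position_selector i).2⟩
  · obtain ⟨x, -, hb, rfl⟩ := ColoredDigraph.rightOpt_position.1 ho
    by_cases hx : ∃ i, x = selector i
    · obtain ⟨i, rfl⟩ := hx
      obtain ⟨r, hrX, hv⟩ := hr i hb
      exact Or.inl ⟨r, hrX, (value_eq_iff.1 hv).2.trans (assembly_position_selector i).2⟩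
    · push Not at hx
      obtain ⟨s, hs, h⟩ := exists_punisher (c := c) (D := D) hx
      have hs' : reserveColor s = VertexColor.blue := by
        rw [hb] at hs; cases hc : reserveColor s <;> simp_all
      have hlt := hpos x hx
      have k : Fin N := ⟨0, by omega⟩
      refine Or.inr ⟨_, ColoredDigraph.leftOpt_position.2
        ⟨reserve s k, reserve_mem_of_survives k (h k).1, hs', rfl⟩, ?_⟩
      rw [assembly_delete_delete k (h k).1 (h k).2]
      exact ColoredDigraph.le_position_of_blue (fun v hv => (hcol s k v hv).trans hs')
        (reserve_not_adj s _) (hcard s k hlt)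

end

end

/-! ### Values born by a given day: finiteness, antichains and width -/

noncomputable section

namespace GameValue

open ShortGame

theorem exists_minimal_rep (x : GameValue) :
    ∃ X : ShortGame, X.value = x ∧ ∀ Y : ShortGame, Y.value = x → X.birthday ≤ Y.birthday := by
  obtain ⟨X, hX, hmin⟩ := (measure ShortGame.birthday).wf.has_min {X | X.value = x}
    (Quotient.exists_rep x)
  exact ⟨X, hX, fun Y hY => not_lt.1 (hmin Y hY)⟩

/-- A game of least birthday among those of a given value. -/
def rep (x : GameValue) : ShortGame := x.exists_minimal_rep.choose

theorem value_rep (x : GameValue) : x.rep.value = x := x.exists_minimal_rep.choose_spec.1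

theorem birthday_rep_le {X : ShortGame} {x : GameValue} (h : X.value = x) :
    x.rep.birthday ≤ X.birthday :=
  x.exists_minimal_rep.choose_spec.2 X h

theorem rep_value_le (X : ShortGame) : X.value.rep ≤ X := (value_eq_iff.1 (value_rep _)).1

theorem le_rep_value (X : ShortGame) : X ≤ X.value.rep := (value_eq_iff.1 (value_rep _)).2

instance : PartialOrder GameValue where
  le x y := x.rep ≤ y.rep
  le_refl x := le_refl x.rep
  le_trans _ _ _ h h' := le_trans (α := ShortGame) h h'
  le_antisymm x y h h' := by
    rw [← value_rep x, ← value_rep y]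
    exact value_eq_iff.2 ⟨h, h'⟩

theorem le_iff_rep {x y : GameValue} : x ≤ y ↔ x.rep ≤ y.rep := Iff.rfl

theorem value_le_value {X Y : ShortGame} : X.value ≤ Y.value ↔ X ≤ Y :=
  ⟨fun h => (le_rep_value X).trans (le_trans (α := ShortGame) h (rep_value_le Y)),
    fun h => (rep_value_le X).trans (h.trans (le_rep_value Y))⟩

theorem mem_bornBy {x : GameValue} {b : ℕ} : x ∈ bornBy b ↔ x.rep.birthday ≤ b :=
  ⟨fun ⟨_, hX, hv⟩ => (birthday_rep_le hv).trans hX, fun h => ⟨x.rep, h, value_rep x⟩⟩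

theorem value_mem_bornBy {X : ShortGame} {b : ℕ} (h : X.birthday ≤ b) : X.value ∈ bornBy b :=
  ⟨X, h, rfl⟩

/-- The game whose Left options represent `A` and whose Right options represent `B`. -/
def ofOptions (A B : Finset GameValue) : ShortGame :=
  -- Options are indexed by `Fin` because `GameValue` lives in `Type 1`, whereas index types must
  -- lie in `Type`.
  ShortGame.mk (Fin A.card) (Fin B.card) (fun i => (A.equivFin.symm i).1.rep)
    (fun j => (B.equivFin.symm j).1.rep)

theorem leftOpt_ofOptions {A B : Finset GameValue} {o : ShortGame} :
    LeftOpt o (ofOptions A B) ↔ ∃ a ∈ A, a.rep = o := by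
  rw [ofOptions, leftOpt_mk, A.equivFin.symm.exists_congr_left]
  simp

theorem rightOpt_ofOptions {A B : Finset GameValue} {o : ShortGame} :
    RightOpt o (ofOptions A B) ↔ ∃ b ∈ B, b.rep = o := by
  rw [ofOptions, rightOpt_mk, B.equivFin.symm.exists_congr_left]
  simp

theorem birthday_ofOptions_le {A B : Finset GameValue} {b : ℕ} (hA : ↑A ⊆ bornBy b)
    (hB : ↑B ⊆ bornBy b) : (ofOptions A B).birthday ≤ b + 1 := by
  refine birthday_le_iff.2 ⟨fun l hl => ?_, fun r hr => ?_⟩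
  · obtain ⟨a, ha, rfl⟩ := leftOpt_ofOptions.1 hl
    exact Nat.lt_succ_of_le (mem_bornBy.1 (hA ha))
  · obtain ⟨a, ha, rfl⟩ := rightOpt_ofOptions.1 hr
    exact Nat.lt_succ_of_le (mem_bornBy.1 (hB ha))

/-- Dominated options can be removed: every value born by day `b + 1` is given by antichains of
options born by day `b`. -/
theorem exists_ofOptions {b : ℕ} (hb : (bornBy b).Finite) {x : GameValue}
    (hx : x ∈ bornBy (b + 1)) :
    ∃ A B : Finset GameValue, ↑A ⊆ bornBy b ∧ IsAntichain (· ≤ ·) (A : Set GameValue) ∧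
      ↑B ⊆ bornBy b ∧ IsAntichain (· ≤ ·) (B : Set GameValue) ∧ (ofOptions A B).value = x := by
  set X := x.rep
  have hX := birthday_le_iff.1 (mem_bornBy.1 hx)
  set P : GameValue → Prop := fun a => ∃ l, LeftOpt l X ∧ l.value = a
  set Q : GameValue → Prop := fun a => ∃ r, RightOpt r X ∧ r.value = a
  have hP : {a | P a} ⊆ bornBy b := by
    rintro _ ⟨l, hl, rfl⟩; exact value_mem_bornBy (Nat.lt_succ_iff.1 (hX.1 l hl))
  have hQ : {a | Q a} ⊆ bornBy b := by
    rintro _ ⟨r, hr, rfl⟩; exact value_mem_bornBy (Nat.lt_succ_iff.1 (hX.2 r hr))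
  have hA : {a | Maximal P a} ⊆ bornBy b := fun a ha => hP ha.prop
  have hB : {a | Minimal Q a} ⊆ bornBy b := fun a ha => hQ ha.prop
  refine ⟨(hb.subset hA).toFinset, (hb.subset hB).toFinset, by simpa using hA,
    by simpa using setOfPred_maximal_antichain P, by simpa using hB,
    by simpa using setOfPred_minimal_antichain Q, ?_⟩
  rw [← value_rep x]
  refine value_eq_iff.2 ⟨le_of_options (fun l hl => ?_) fun r hr => ?_,
    le_of_options (fun l hl => ?_) fun r hr => ?_⟩
  · obtain ⟨a, ha, rfl⟩ := leftOpt_ofOptions.1 hl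
    obtain ⟨m, hm, rfl⟩ := (((hb.subset hA).mem_toFinset).1 ha).prop
    exact Or.inl ⟨m, hm, rep_value_le m⟩
  · obtain ⟨a, ha, hmin⟩ := (hb.subset hQ).exists_le_minimal (show Q r.value from ⟨r, hr, rfl⟩)
    exact Or.inl ⟨a.rep, rightOpt_ofOptions.2 ⟨a, (Set.Finite.mem_toFinset _).2 hmin, rfl⟩,
      (le_iff_rep.1 ha).trans (rep_value_le r)⟩
  · obtain ⟨a, ha, hmax⟩ := (hb.subset hP).exists_le_maximal (show P l.value from ⟨l, hl, rfl⟩)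
    exact Or.inl ⟨a.rep, leftOpt_ofOptions.2 ⟨a, (Set.Finite.mem_toFinset _).2 hmax, rfl⟩,
      (le_rep_value l).trans (le_iff_rep.1 ha)⟩
  · obtain ⟨a, ha, rfl⟩ := rightOpt_ofOptions.1 hr
    obtain ⟨m, hm, rfl⟩ := (((hb.subset hB).mem_toFinset).1 ha).prop
    exact Or.inl ⟨m, hm, le_rep_value m⟩

theorem eq_of_birthday_eq_zero {X Y : ShortGame} (hX : X.birthday = 0) (hY : Y.birthday = 0) :
    X.value = Y.value := by
  refine value_eq_iff.2 ⟨le_of_options (fun l hl => ?_) fun r hr => ?_,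
    le_of_options (fun l hl => ?_) fun r hr => ?_⟩
  · exact absurd hl.birthday_lt (by omega)
  · exact absurd hr.birthday_lt (by omega)
  · exact absurd hl.birthday_lt (by omega)
  · exact absurd hr.birthday_lt (by omega)

theorem bornBy_zero : bornBy 0 = {(negNat 0).value} := by
  ext x
  rw [Set.mem_singleton_iff]
  constructor
  · rintro ⟨X, hX, rfl⟩
    exact eq_of_birthday_eq_zero (Nat.le_zero.1 hX) (Nat.le_zero.1 (birthday_negNat_le 0))
  · rintro rfl
    exact value_mem_bornBy (birthday_negNat_le 0)

theorem bornBy_succ_subset {b : ℕ} (hb : (bornBy b).Finite) :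
    bornBy (b + 1) ⊆ (fun p : Finset GameValue × Finset GameValue => (ofOptions p.1 p.2).value) ''
      ↑(hb.toFinset.powerset ×ˢ hb.toFinset.powerset) := by
  intro x hx
  obtain ⟨A, B, hA, -, hB, -, h⟩ := exists_ofOptions hb hx
  refine ⟨(A, B), ?_, h⟩
  simp only [Finset.coe_product, Set.mem_prod, Finset.mem_coe, Finset.mem_powerset,
    Set.Finite.subset_toFinset]
  exact ⟨hA, hB⟩

theorem finite_bornBy (b : ℕ) : (bornBy b).Finite := by
  induction b with
  | zero => rw [bornBy_zero]; exact Set.finite_singleton _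
  | succ b ih => exact ((Finset.finite_toSet _).image _).subset (bornBy_succ_subset ih)

theorem g_zero : g 0 = 1 := by rw [g, bornBy_zero, Set.ncard_singleton]

theorem g_succ_le (b : ℕ) : g (b + 1) ≤ 2 ^ g b * 2 ^ g b := by
  refine (Set.ncard_le_ncard (bornBy_succ_subset (finite_bornBy b))
    ((Finset.finite_toSet _).image _)).trans ((Set.ncard_image_le (Finset.finite_toSet _)).trans ?_)
  rw [Set.ncard_coe_finset, Finset.card_product, Finset.card_powerset, g,
    Set.ncard_eq_toFinset_card _ (finite_bornBy b)]

theorem card_le_g {b : ℕ} {A : Finset GameValue} (h : ↑A ⊆ bornBy b) : A.card ≤ g b := by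
  rw [← Set.ncard_coe_finset]
  exact Set.ncard_le_ncard h (finite_bornBy b)

/-- The sizes of the antichains of values born by day `b`. -/
def antichainSizes (b : ℕ) : Set ℕ :=
  {n | ∃ A : Finset GameValue, ↑A ⊆ bornBy b ∧ IsAntichain (· ≤ ·) (A : Set GameValue) ∧
    A.card = n}

/-- The greatest size of an antichain of values born by day `b`. -/
def width (b : ℕ) : ℕ := sSup (antichainSizes b)

theorem g_mem_upperBounds (b : ℕ) : g b ∈ upperBounds (antichainSizes b) := by
  rintro _ ⟨A, hA, -, rfl⟩
  exact card_le_g hA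

theorem exists_card_eq_width (b : ℕ) : width b ∈ antichainSizes b :=
  Nat.sSup_mem ⟨0, ∅, by simp, by simp, rfl⟩ ⟨_, g_mem_upperBounds b⟩

theorem width_le_g (b : ℕ) : width b ≤ g b := g_mem_upperBounds b (exists_card_eq_width b)

theorem card_le_width {b : ℕ} {A : Finset GameValue} (h : ↑A ⊆ bornBy b)
    (hA : IsAntichain (· ≤ ·) (A : Set GameValue)) : A.card ≤ width b :=
  le_csSup ⟨_, g_mem_upperBounds b⟩ ⟨A, h, hA, rfl⟩

/-! ### Upper bounds for placement orders -/

/-- Every value born by day `b` is that of a placement game on at most `M` vertices. -/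
def PlacementBound (b M : ℕ) : Prop :=
  ∀ x ∈ bornBy b, ∃ n ≤ M, x.IsPlacementOrder n

theorem placementBound_zero : PlacementBound 0 0 := by
  rintro _ ⟨X, hX, rfl⟩
  refine ⟨0, le_rfl, Empty, inferInstance, ⟨⊥, Empty.elim⟩, rfl, eq_of_birthday_eq_zero ?_
    (Nat.le_zero.1 hX)⟩
  refine Nat.le_zero.1 (birthday_le_iff.2 ⟨fun l hl => ?_, fun r hr => ?_⟩)
  · obtain ⟨v, -⟩ := ColoredDigraph.leftOpt_position.1 hl
    exact v.elim
  · obtain ⟨v, -⟩ := ColoredDigraph.rightOpt_position.1 hr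
    exact v.elim

/-- Each of the at most 2 · `width b` options costs a selector and at most `M` vertices, and the
reserves cost 4 · `N`. The case `N = M = 0` avoids reserves on day one, where they would be too
expensive. -/
theorem PlacementBound.succ_of {b M N : ℕ} (h : PlacementBound b M)
    (hN : (N = 0 ∧ M = 0) ∨ b + 1 < N) :
    PlacementBound (b + 1) (2 * width b * (M + 1) + 4 * N) := by
  intro x hx
  obtain ⟨A, B, hA, hA', hB, hB', rfl⟩ := exists_ofOptions (finite_bornBy b) hx
  let opt : Fin A.card ⊕ Fin B.card → GameValue :=
    Sum.elim (fun i => (A.equivFin.symm i).1) (fun j => (B.equivFin.symm j).1)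
  have hopt : ∀ i, opt i ∈ bornBy b := by
    rintro (i | j)
    · exact hA (A.equivFin.symm i).2
    · exact hB (B.equivFin.symm j).2
  choose n hn V inst D hV hD using fun i => h (opt i) (hopt i)
  let c : Fin A.card ⊕ Fin B.card → VertexColor :=
    Sum.elim (fun _ => VertexColor.blue) (fun _ => VertexColor.red)
  have hD' : ∀ i, (D i).game.value = (opt i).rep.value := fun i => by rw [hD, value_rep]
  refine ⟨_, ?_, _, inferInstance, assembly c D N, rfl, assembly_game_value ?_ ?_ ?_ ?_ ?_⟩
  · rw [AssemblyVertex.card_eq, Fintype.card_sum, Fintype.card_fin, Fintype.card_fin]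
    have h1 := card_le_width hA hA'
    have h2 := card_le_width hB hB'
    have h3 : ∑ i, Fintype.card (V i) ≤ ∑ _i : Fin A.card ⊕ Fin B.card, M :=
      Finset.sum_le_sum fun i _ => (hV i).trans_le (hn i)
    simp only [Finset.sum_const, Finset.card_univ, Fintype.card_sum, Fintype.card_fin,
      smul_eq_mul] at h3
    nlinarith [Nat.mul_le_mul_right M (Nat.add_le_add h1 h2)]
  · rintro (i | j) hi
    · exact ⟨_, ⟨i, rfl⟩, hD' (Sum.inl i)⟩
    · cases hi
  · rintro _ ⟨i, rfl⟩
    exact ⟨Sum.inl i, rfl, hD' (Sum.inl i)⟩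
  · rintro (i | j) hi
    · cases hi
    · exact ⟨_, ⟨j, rfl⟩, hD' (Sum.inr j)⟩
  · rintro _ ⟨j, rfl⟩
    exact ⟨Sum.inr j, rfl, hD' (Sum.inr j)⟩
  · rcases hN with ⟨rfl, rfl⟩ | hN
    · exact Or.inl ⟨rfl, fun i => Fintype.card_eq_zero_iff.1 ((hV i).trans (Nat.le_zero.1 (hn i)))⟩
    · exact Or.inr ((birthday_ofOptions_le hA hB).trans_lt hN)

theorem PlacementBound.succ {b M : ℕ} (h : PlacementBound b M) :
    PlacementBound (b + 1) (2 * width b * (M + 1) + 4 * (b + 2)) :=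
  h.succ_of (Or.inr (Nat.lt_succ_self _))

theorem PlacementBound.f_le {b M : ℕ} (h : PlacementBound b M) {x : GameValue}
    (hx : x ∈ bornBy b) : x.f ≤ M := by
  obtain ⟨n, hn, hxn⟩ := h x hx
  exact (Nat.sInf_le hxn).trans hn

theorem isGreatest_F (b : ℕ) : IsGreatest (f '' bornBy b) (F b) := by
  have hne : (f '' bornBy b).Nonempty :=
    ⟨_, (negNat 0).value, value_mem_bornBy ((birthday_negNat_le 0).trans (Nat.zero_le b)), rfl⟩
  have hbdd := ((finite_bornBy b).image f).bddAbove
  exact ⟨Nat.sSup_mem hne hbdd, fun _ h => le_csSup hbdd h⟩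

theorem PlacementBound.F_le {b M : ℕ} (h : PlacementBound b M) : F b ≤ M := by
  obtain ⟨x, hx, hF⟩ := (isGreatest_F b).1
  exact hF ▸ h.f_le hx

/-! ### Lower bounds for the number of values and the width -/

/-- The value `{A | -b}`. -/
def ideal (b : ℕ) (A : Finset GameValue) : GameValue := (ofOptions A {(negNat b).value}).value

theorem ideal_mem_bornBy {b : ℕ} {A : Finset GameValue} (hA : ↑A ⊆ bornBy b) :
    ideal b A ∈ bornBy (b + 1) :=
  value_mem_bornBy (birthday_ofOptions_le hA
    (by simpa using value_mem_bornBy (birthday_negNat_le b)))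

/-- No option of `{A | -b}` is reversible if `A` consists of values born by day `b`. -/
theorem subset_of_ideal_le {b : ℕ} {S A A' : Finset GameValue} (hS : ↑S ⊆ bornBy b)
    (hS' : IsAntichain (· ≤ ·) (S : Set GameValue)) (hA : A ⊆ S) (hA' : A' ⊆ S)
    (h : ideal b A ≤ ideal b A') : A ⊆ A' := by
  intro a ha
  have hl : LeftOpt a.rep (ofOptions A {(negNat b).value}) := leftOpt_ofOptions.2 ⟨a, ha, rfl⟩
  rcases not_le_def.1 (hl.not_le_of_le (value_le_value.1 h)) with ⟨m, hm, hle⟩ | ⟨r, hr, hle⟩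
  · obtain ⟨a', ha', rfl⟩ := leftOpt_ofOptions.1 hm
    rwa [hS'.eq (hA ha) (hA' ha') (le_iff_rep.2 hle)]
  -- Reversal through `r` is impossible: `r` is born by day b, so `-b ≤ r`, while the Right option
  -- `-b` is not at most the game.
  · have hrb : r.birthday ≤ b := hr.birthday_lt.le.trans (mem_bornBy.1 (hS (hA ha)))
    have ho : RightOpt (negNat b).value.rep (ofOptions A' {(negNat b).value}) :=
      rightOpt_ofOptions.2 ⟨_, Finset.mem_singleton_self _, rfl⟩
    exact (ho.not_le (((rep_value_le _).trans (negNat_le hrb)).trans hle)).elim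

theorem injOn_ideal {b : ℕ} {S : Finset GameValue} (hS : ↑S ⊆ bornBy b)
    (hS' : IsAntichain (· ≤ ·) (S : Set GameValue)) : Set.InjOn (ideal b) ↑S.powerset := by
  intro A hA A' hA' h
  rw [Finset.mem_coe, Finset.mem_powerset] at hA hA'
  exact (subset_of_ideal_le hS hS' hA hA' h.le).antisymm (subset_of_ideal_le hS hS' hA' hA h.ge)

theorem two_pow_width_le_g (b : ℕ) : 2 ^ width b ≤ g (b + 1) := by
  classical
  obtain ⟨S, hS, hS', hc⟩ := exists_card_eq_width b
  rw [← hc, ← Finset.card_powerset, ← Finset.card_image_of_injOn (injOn_ideal hS hS')]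
  refine card_le_g fun x hx => ?_
  obtain ⟨A, hA, rfl⟩ := Finset.mem_image.1 (Finset.mem_coe.1 hx)
  exact ideal_mem_bornBy fun a ha => hS (Finset.mem_powerset.1 hA ha)

/-- Since `ideal b` reflects the order to inclusion, distinct subsets of equal size have
incomparable images. -/
theorem choose_width_le (b k : ℕ) : (width b).choose k ≤ width (b + 1) := by
  classical
  obtain ⟨S, hS, hS', hc⟩ := exists_card_eq_width b
  have hsub : ∀ A ∈ S.powersetCard k, A ⊆ S := fun A hA => (Finset.mem_powersetCard.1 hA).1
  have hinj : Set.InjOn (ideal b) ↑(S.powersetCard k) := (injOn_ideal hS hS').mono fun A hA =>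
    Finset.mem_coe.2 (Finset.mem_powerset.2 (hsub A hA))
  rw [← hc, ← Finset.card_powersetCard, ← Finset.card_image_of_injOn hinj]
  refine card_le_width (fun x hx => ?_) fun x hx y hy hne hle => hne ?_
  · obtain ⟨A, hA, rfl⟩ := Finset.mem_image.1 (Finset.mem_coe.1 hx)
    exact ideal_mem_bornBy fun a ha => hS (hsub A hA ha)
  · obtain ⟨A, hA, rfl⟩ := Finset.mem_image.1 (Finset.mem_coe.1 hx)
    obtain ⟨A', hA', rfl⟩ := Finset.mem_image.1 (Finset.mem_coe.1 hy)
    have := subset_of_ideal_le hS hS' (hsub A hA) (hsub A' hA') hle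
    rw [Finset.eq_of_subset_of_card_le this (by
      rw [(Finset.mem_powersetCard.1 hA).2, (Finset.mem_powersetCard.1 hA').2])]

end GameValue

end

/-! ### Computed lower bounds for days two and three -/

noncomputable section

/-- Finite trees that code games: `mk L R` codes the game with options coded by `L` and `R`. -/
inductive GameCode : Type
  | mk (L R : List GameCode) : GameCode

namespace GameCode

open ShortGame

/-- The game with a given code. -/
def toGame : GameCode → ShortGame
  | mk L R => ShortGame.mk (Fin L.length) (Fin R.length) (fun i => toGame L[i])
      (fun j => toGame R[j])
decreasing_by
  · have := List.sizeOf_lt_of_mem (L.getElem_mem i.2)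
    simp only [GameCode.mk.sizeOf_spec, Fin.getElem_fin]
    omega
  · have := List.sizeOf_lt_of_mem (R.getElem_mem j.2)
    simp only [GameCode.mk.sizeOf_spec, Fin.getElem_fin]
    omega

theorem leftOpt_toGame {L R : List GameCode} {o : ShortGame} :
    LeftOpt o (mk L R).toGame ↔ ∃ x ∈ L, x.toGame = o := by
  rw [toGame, leftOpt_mk]
  constructor
  · rintro ⟨i, rfl⟩; exact ⟨_, L.getElem_mem i.2, rfl⟩
  · rintro ⟨x, hx, rfl⟩
    obtain ⟨i, hi, rfl⟩ := List.getElem_of_mem hx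
    exact ⟨⟨i, hi⟩, rfl⟩

theorem rightOpt_toGame {L R : List GameCode} {o : ShortGame} :
    RightOpt o (mk L R).toGame ↔ ∃ x ∈ R, x.toGame = o := by
  rw [toGame, rightOpt_mk]
  constructor
  · rintro ⟨i, rfl⟩; exact ⟨_, R.getElem_mem i.2, rfl⟩
  · rintro ⟨x, hx, rfl⟩
    obtain ⟨i, hi, rfl⟩ := List.getElem_of_mem hx
    exact ⟨⟨i, hi⟩, rfl⟩

/-- `bornBy b x` decides whether the game coded by `x` has birthday at most `b`. -/
def bornBy : ℕ → GameCode → Bool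
  | 0, mk L R => L.isEmpty && R.isEmpty
  | b + 1, mk L R => L.all (bornBy b) && R.all (bornBy b)

/-- The order of games on codes, with `n` bounding the depth of the recursion. -/
def leFuel : ℕ → GameCode → GameCode → Bool
  | 0, _, _ => true
  | n + 1, mk L R, mk L' R' =>
    L.all (fun l => !leFuel n (mk L' R') l) && R'.all (fun r => !leFuel n r (mk L R))

theorem birthday_toGame_le {b : ℕ} {x : GameCode} (h : bornBy b x = true) :
    x.toGame.birthday ≤ b := by
  induction b generalizing x with
  | zero =>
    obtain ⟨L, R⟩ := x
    simp only [bornBy, Bool.and_eq_true, List.isEmpty_iff] at h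
    obtain ⟨rfl, rfl⟩ := h
    refine birthday_le_iff.2 ⟨fun l hl => ?_, fun r hr => ?_⟩
    · obtain ⟨y, hy, -⟩ := leftOpt_toGame.1 hl; simp at hy
    · obtain ⟨y, hy, -⟩ := rightOpt_toGame.1 hr; simp at hy
  | succ b ih =>
    obtain ⟨L, R⟩ := x
    simp only [bornBy, Bool.and_eq_true, List.all_eq_true] at h
    refine birthday_le_iff.2 ⟨fun l hl => ?_, fun r hr => ?_⟩
    · obtain ⟨y, hy, rfl⟩ := leftOpt_toGame.1 hl; exact Nat.lt_succ_of_le (ih (h.1 y hy))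
    · obtain ⟨y, hy, rfl⟩ := rightOpt_toGame.1 hr; exact Nat.lt_succ_of_le (ih (h.2 y hy))

/-- Each call lowers the sum of birthdays, so the default answer at fuel 0 is never reached. -/
theorem leFuel_iff {n : ℕ} {x y : GameCode} (h : x.toGame.birthday + y.toGame.birthday < n) :
    leFuel n x y = true ↔ x.toGame ≤ y.toGame := by
  induction n generalizing x y with
  | zero => omega
  | succ n ih =>
    obtain ⟨L, R⟩ := x
    obtain ⟨L', R'⟩ := y
    simp only [leFuel, Bool.and_eq_true, List.all_eq_true, Bool.not_eq_true',
      ← Bool.not_eq_true]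
    rw [le_def]
    refine and_congr ⟨fun H l hl => ?_, fun H l hl => ?_⟩ ⟨fun H r hr => ?_, fun H r hr => ?_⟩
    · obtain ⟨z, hz, rfl⟩ := leftOpt_toGame.1 hl
      have := hl.birthday_lt
      rw [← ih (by omega)]
      exact H z hz
    · have ho : LeftOpt l.toGame (mk L R).toGame := leftOpt_toGame.2 ⟨l, hl, rfl⟩
      have := ho.birthday_lt
      rw [ih (by omega)]
      exact H _ ho
    · obtain ⟨z, hz, rfl⟩ := rightOpt_toGame.1 hr
      have := hr.birthday_lt
      rw [← ih (by omega)]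
      exact H z hz
    · have ho : RightOpt r.toGame (mk L' R').toGame := rightOpt_toGame.2 ⟨r, hr, rfl⟩
      have := ho.birthday_lt
      rw [ih (by omega)]
      exact H _ ho

/-- A natural number that records how the game coded by `x` compares with those in `T`. -/
def signature (n : ℕ) (T : List GameCode) (x : GameCode) : ℕ :=
  T.foldl (fun s t => 4 * s + 2 * (leFuel n t x).toNat + (leFuel n x t).toNat) 0

theorem leFuel_congr {n : ℕ} {x y t : GameCode} (h : x.toGame.value = y.toGame.value)
    (hx : t.toGame.birthday + x.toGame.birthday < n)
    (hy : t.toGame.birthday + y.toGame.birthday < n) :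
    leFuel n t x = leFuel n t y ∧ leFuel n x t = leFuel n y t := by
  obtain ⟨h1, h2⟩ := value_eq_iff.1 h
  constructor
  · rw [Bool.eq_iff_iff, leFuel_iff hx, leFuel_iff hy]
    exact ⟨fun H => H.trans h1, fun H => H.trans h2⟩
  · rw [Bool.eq_iff_iff, leFuel_iff (by omega), leFuel_iff (by omega)]
    exact ⟨fun H => h2.trans H, fun H => h1.trans H⟩

/-- Games of equal value compare alike with every test game in `T`, so distinct signatures mean
distinct values. Fuel 2b + 1 exceeds any sum of two birthdays. -/
theorem card_signature_le_g {b : ℕ} {l T : List GameCode} (hl : l.all (bornBy b) = true)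
    (hT : T.all (bornBy b) = true) :
    (l.map (signature (2 * b + 1) T)).toFinset.card ≤ GameValue.g b := by
  classical
  have hb : ∀ x ∈ l, x.toGame.birthday ≤ b := fun x hx =>
    birthday_toGame_le (List.all_eq_true.1 hl x hx)
  have hbT : ∀ x ∈ T, x.toGame.birthday ≤ b := fun x hx =>
    birthday_toGame_le (List.all_eq_true.1 hT x hx)
  set A : Finset GameValue := (l.map fun x => x.toGame.value).toFinset
  have hA : ↑A ⊆ GameValue.bornBy b := by
    intro v hv
    obtain ⟨x, hx, rfl⟩ := List.mem_map.1 (List.mem_toFinset.1 (Finset.mem_coe.1 hv))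
    exact GameValue.value_mem_bornBy (hb x hx)
  refine le_trans ?_ (GameValue.card_le_g hA)
  have hsig : ∀ x ∈ l, ∀ y ∈ l, x.toGame.value = y.toGame.value →
      signature (2 * b + 1) T x = signature (2 * b + 1) T y := by
    intro x hx y hy h
    have hx' := hb x hx
    have hy' := hb y hy
    refine List.foldl_ext _ _ _ fun s t ht => ?_
    have ht' := hbT t ht
    obtain ⟨h1, h2⟩ := leFuel_congr (n := 2 * b + 1) (t := t) h (by omega) (by omega)
    rw [h1, h2]
  refine Finset.card_le_card_of_forall_subsingleton
    (fun s v => ∃ x ∈ l, signature (2 * b + 1) T x = s ∧ x.toGame.value = v) ?_ ?_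
  · intro s hs
    obtain ⟨x, hx, rfl⟩ := List.mem_map.1 (List.mem_toFinset.1 hs)
    exact ⟨_, List.mem_toFinset.2 (List.mem_map.2 ⟨x, hx, rfl⟩), x, hx, rfl, rfl⟩
  · rintro v - s ⟨-, x, hx, rfl, rfl⟩ s' ⟨-, y, hy, rfl, hv⟩
    exact hsig x hx y hy hv.symm

theorem length_le_width {b : ℕ} {l : List GameCode} (hl : l.all (bornBy b) = true)
    (h : l.Pairwise fun x y =>
      leFuel (2 * b + 1) x y = false ∧ leFuel (2 * b + 1) y x = false) :
    l.length ≤ GameValue.width b := by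
  classical
  have hb : ∀ x ∈ l, x.toGame.birthday ≤ b := fun x hx =>
    birthday_toGame_le (List.all_eq_true.1 hl x hx)
  have h' : (l.map fun x => x.toGame.value).Pairwise fun v w => ¬ v ≤ w ∧ ¬ w ≤ v := by
    rw [List.pairwise_map]
    refine h.imp_of_mem fun {x y} hx hy hxy => ?_
    have hx' := hb x hx
    have hy' := hb y hy
    rw [GameValue.value_le_value, GameValue.value_le_value, ← leFuel_iff (n := 2 * b + 1)
      (by omega), ← leFuel_iff (n := 2 * b + 1) (by omega), hxy.1, hxy.2]
    simp
  have hnd : (l.map fun x => x.toGame.value).Nodup := h'.imp fun hvw heq => hvw.1 heq.le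
  rw [← List.length_map (f := fun x => x.toGame.value), ← List.toFinset_card_of_nodup hnd]
  refine GameValue.card_le_width (fun v hv => ?_) fun v hv w hw hne => ?_
  · obtain ⟨x, hx, rfl⟩ := List.mem_map.1 (List.mem_toFinset.1 (Finset.mem_coe.1 hv))
    exact GameValue.value_mem_bornBy (hb x hx)
  · have hsymm : Std.Symm (fun v w : GameValue => ¬ v ≤ w ∧ ¬ w ≤ v) := ⟨fun _ _ h => h.symm⟩
    exact (h'.forall (List.mem_toFinset.1 hv) (List.mem_toFinset.1 hw) hne).1

/-- The code of `0`. -/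
def zero : GameCode := mk [] []

/-- The code of `1`. -/
def one : GameCode := mk [zero] []

/-- The code of `2`. -/
def two : GameCode := mk [one] []

/-- The code of `-1`. -/
def negOne : GameCode := mk [] [zero]

/-- The code of `-2`. -/
def negTwo : GameCode := mk [] [negOne]

/-- The code of `*`. -/
def star : GameCode := mk [zero] [zero]

/-- The code of `*2`. -/
def starTwo : GameCode := mk [zero, star] [zero, star]

/-- The code of the switch `{1 | -1}`. -/
def switch : GameCode := mk [one] [negOne]

theorem eight_le_g_two : 8 ≤ GameValue.g 2 :=
  le_trans (by decide +kernel)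
    (card_signature_le_g (b := 2) (T := [zero, star, starTwo, switch, one])
      (l := [zero, star, starTwo, switch, one, two, negOne, negTwo]) (by decide) (by decide))

/-- The six pairs from 0, *, *2, ±1 against -2 are joined by four games with Right option -1. Ten is
what the base case of `exists_placementBound_add_le` needs: 74 · 4 + 20 ≤ 2^9. -/
theorem ten_le_width_three : 10 ≤ GameValue.width 3 :=
  length_le_width (l := [mk [zero, star] [negTwo], mk [zero, starTwo] [negTwo],
    mk [zero, switch] [negTwo], mk [star, starTwo] [negTwo], mk [star, switch] [negTwo],
    mk [starTwo, switch] [negTwo], mk [zero] [negOne], mk [star] [negOne], mk [starTwo] [negOne],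
    mk [negOne, switch] [negOne]]) (by decide +kernel) (by decide +kernel)

/-- Antichains of games born by day two. -/
def antichains : List (List GameCode) :=
  [[one], [two], [negOne], [negTwo], [one, switch], [negOne, switch]] ++
    [zero, star, starTwo, switch].sublists

/-- Games born by day three whose options for one player form an antichain and whose option for
the other player is `±1` or `±2`. -/
def dayThree : List GameCode :=
  antichains.map (mk · [negOne]) ++ antichains.map (mk · [negTwo]) ++
    (antichains.map (mk [one] ·) ++ antichains.map (mk [two] ·))

/-- The threshold is 2 · (36 + 2), with 36 from `placementBound_two`. -/
theorem lt_g_three : 76 < GameValue.g 3 :=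
  lt_of_lt_of_le (by decide +kernel)
    (card_signature_le_g (b := 3) (T := [two, one, zero, negOne, negTwo, star, starTwo, switch,
      mk [star] [negOne], mk [one] [star]]) (l := dayThree) (by decide +kernel) (by decide +kernel))

end GameCode

end

/-! ### Comparing the two growth rates -/

namespace GameValue

theorem placementBound_one : PlacementBound 1 2 := by
  have h := placementBound_zero.succ_of (N := 0) (Or.inl ⟨rfl, rfl⟩)
  have hw := (width_le_g 0).trans_eq g_zero
  intro x hx
  obtain ⟨n, hn, hxn⟩ := h x hx
  exact ⟨n, by omega, hxn⟩

/-- 36 = 2 · 4 · (2 + 1) + 4 · 3. -/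
theorem placementBound_two : PlacementBound 2 36 := by
  have hw : width 1 ≤ 4 := (width_le_g 1).trans ((g_succ_le 0).trans (by rw [g_zero]; norm_num))
  intro x hx
  obtain ⟨n, hn, hxn⟩ := placementBound_one.succ x hx
  exact ⟨n, by omega, hxn⟩

theorem two_mul_le_choose_half {w : ℕ} (hw : 5 ≤ w) : 2 * w ≤ w.choose 2 := by
  rw [Nat.choose_two_right, Nat.le_div_iff_mul_le two_pos]
  have : 4 ≤ w - 1 := by omega
  nlinarith [Nat.mul_le_mul_left w this]

theorem two_mul_width_le {b : ℕ} (hw : 5 ≤ width b) : 2 * width b ≤ width (b + 1) :=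
  (two_mul_le_choose_half hw).trans (choose_width_le b 2)

theorem linear_le_two_pow {w : ℕ} (hw : 5 ≤ w) : 74 * w + 20 ≤ 2 ^ (2 * w - 1) := by
  induction w, hw using Nat.le_induction with
  | base => norm_num
  | succ w hw ih =>
    have : 2 * (w + 1) - 1 = 2 * w - 1 + 2 := by omega
    rw [this, pow_add]
    omega

/-- From day three on, the size of placement games is controlled by the width of the order on the
values. -/
theorem exists_placementBound_add_le (b : ℕ) (hb : 3 ≤ b) :
    9 < width b ∧ ∃ M, PlacementBound b M ∧ M + b + 1 ≤ 2 ^ (width b - 1) := by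
  induction b, hb using Nat.le_induction with
  | base =>
    have h3 := GameCode.ten_le_width_three
    refine ⟨h3, _, placementBound_two.succ, ?_⟩
    -- The claim is 74 w_2 + 20 ≤ 2^(w_3 - 1). Either w_3 ≥ 2 w_2, or w_2 ≤ 4 and w_3 ≥ 10 suffices.
    rcases le_or_gt 5 (width 2) with h | h
    · have h1 : 2 * width 2 ≤ width 3 := two_mul_width_le h
      have h2 := linear_le_two_pow h
      have h4 : 2 ^ (2 * width 2 - 1) ≤ 2 ^ (width 3 - 1) :=
        Nat.pow_le_pow_right two_pos (by omega)
      omega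
    · have h4 : 2 ^ 9 ≤ 2 ^ (width 3 - 1) := Nat.pow_le_pow_right two_pos (by omega)
      omega
  | succ b hb ih =>
    obtain ⟨hw, M, hM, hle⟩ := ih
    have h1 := two_mul_width_le (by omega : 5 ≤ width b)
    refine ⟨by omega, _, hM.succ, ?_⟩
    obtain ⟨w, hwe⟩ : ∃ w, width b = w + 1 := ⟨width b - 1, by omega⟩
    rw [hwe] at h1 hle hw ⊢
    have h2 : 2 ^ (w + (w + 1)) ≤ 2 ^ (width (b + 1) - 1) :=
      Nat.pow_le_pow_right two_pos (by omega)
    have h3 : w + 1 ≤ 2 ^ w := Nat.lt_two_pow_self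
    rw [pow_add, pow_succ] at h2
    rw [Nat.add_sub_cancel] at hle
    -- Twice this bounds 2(w + 1)(M + 1) + 2(w + 1)b by 2^(2w + 1); the second summand absorbs the
    -- remaining 5b + 10.
    have h4 : (w + 1) * (M + 1) + (w + 1) * b ≤ 2 ^ w * 2 ^ w := by
      rw [← mul_add]; exact Nat.mul_le_mul h3 (by omega)
    have h5 : 9 * b ≤ (w + 1) * b := Nat.mul_le_mul_right b (by omega)
    nlinarith

theorem exists_placementBound_lt (b : ℕ) (hb : 1 ≤ b) :
    ∃ M, PlacementBound b M ∧ 2 * (M + b) < g (b + 1) := by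
  rcases (by omega : b = 1 ∨ b = 2 ∨ 3 ≤ b) with rfl | rfl | hb3
  · have : 8 ≤ g (1 + 1) := GameCode.eight_le_g_two
    exact ⟨2, placementBound_one, by omega⟩
  · have : 76 < g (2 + 1) := GameCode.lt_g_three
    exact ⟨36, placementBound_two, by omega⟩
  · obtain ⟨hw, M, hM, hle⟩ := exists_placementBound_add_le b hb3
    refine ⟨M, hM, lt_of_lt_of_le ?_ (two_pow_width_le_g b)⟩
    obtain ⟨w, hwe⟩ : ∃ w, width b = w + 1 := ⟨width b - 1, by omega⟩
    rw [hwe, Nat.add_sub_cancel] at hle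
    rw [hwe, pow_succ]
    omega

end GameValue

/-- The first three conjuncts say that `g (b + 1)`, the numbers `f x` for `x` born by day `b`, and
`F b` are well defined: the set counted by `g (b + 1)` is finite, every `x` born by day `b` is the
value of a digraph placement game, and the maximum `F b` is attained. -/
theorem mainTheorem8 (b : ℕ) (hb : 1 ≤ b) :
    (GameValue.bornBy (b + 1)).Finite ∧
    (∀ x ∈ GameValue.bornBy b, ∃ n : ℕ, x.IsPlacementOrder n) ∧
    IsGreatest (GameValue.f '' GameValue.bornBy b) (GameValue.F b) ∧
    (GameValue.F b : ℝ) < (1 / 2 : ℝ) * (GameValue.g (b + 1) : ℝ) - (b : ℝ) := by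
  obtain ⟨M, hM, hlt⟩ := GameValue.exists_placementBound_lt b hb
  refine ⟨GameValue.finite_bornBy _, fun x hx => (hM x hx).imp fun _ h => h.2,
    GameValue.isGreatest_F b, ?_⟩
  have h : 2 * (GameValue.F b + b) < GameValue.g (b + 1) :=
    lt_of_le_of_lt (by have := hM.F_le; omega) hlt
  have h' : (2 : ℝ) * (GameValue.F b + b) < GameValue.g (b + 1) := by exact_mod_cast h
  linarith
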